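/- All lattices and matroids are finite, and lattices are nonempty. A flat $X$ of a matroid $M$ is cyclic if the restriction $M|X$ has no isthmuses (coloops); ordered by inclusion, the cyclic flats of $M$ form a lattice $\mathcal{Z}(M)$. A matroid is transversal if its independent sets are exactly the partial transversals of some finite family of subsets of its ground set. A lattice $L$ is a Tr-lattice if every matroid $M$ with $\mathcal{Z}(M)$ isomorphic to $L$ is transversal. Given lattices $L_1$ and $L_2$ (taken to be disjoint) with greatest elements $\hat{1}_{L_1}$ and $\hat{1}_{L_2}$, let $L_1*L_2$ be the lattice on the set $(L_1\setminus\{\hat{1}_{L_1}\})\cup(L_2\setminus\{\hat{1}_{L_2}\})\cup\{\hat{0},\hat{1}\}$, where $\hat{0}$ and $\hat{1}$ are new elements, with $x\le y$ if and only if (i) $y=\hat{1}$, or (ii) $x=\hat{0}$, or (iii) for some $i\in\{1,2\}$, both $x$ and $y$ are in $L_i$ and $x\le y$ in $L_i$. Theorem. If $L_1$ and $L_2$ are Tr-lattices, then so is $L_1*L_2$. -/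

import Mathlib

universe u₁ u₂ v

namespace Matroid

/-- A flat `X` of `M` is cyclic if the restriction `M ↾ X` has no coloops (isthmuses). -/
def IsCyclicFlat {α : Type v} (M : Matroid α) (X : Set α) : Prop :=
  M.IsFlat X ∧ ∀ e, ¬ (M ↾ X).IsColoop e

/-- The cyclic flats of `M`, ordered by inclusion. -/
abbrev CyclicFlat {α : Type v} (M : Matroid α) : Type v :=
  {X : Set α // M.IsCyclicFlat X}

/-- `M` is transversal if there is a finite family `A` of subsets of the ground set whose partial
transversals are exactly the independent sets of `M`. -/
def IsTransversal {α : Type v} (M : Matroid α) : Prop :=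
  ∃ (m : ℕ) (A : Fin m → Set α), (∀ i, A i ⊆ M.E) ∧
    ∀ I : Set α, M.Indep I ↔ ∃ f : I → Fin m, Function.Injective f ∧ ∀ e : I, (e : α) ∈ A (f e)

end Matroid

/-- A finite lattice `L` is a Tr-lattice if every (finite) matroid whose lattice of cyclic flats is
isomorphic to `L` is transversal. -/
def IsTrLattice (L : Type u₁) [Lattice L] [Finite L] : Prop :=
  ∀ (α : Type v) (M : Matroid α), M.Finite → Nonempty (M.CyclicFlat ≃o L) → M.IsTransversal

/-- The underlying set of `L₁ * L₂`: the disjoint union of `L₁` and `L₂` with their greatest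
elements removed, together with a new least and a new greatest element. -/
inductive StarLattice (L₁ : Type u₁) (L₂ : Type u₂) [LE L₁] [OrderTop L₁] [LE L₂] [OrderTop L₂] :
    Type (max u₁ u₂)
  | bot : StarLattice L₁ L₂
  | top : StarLattice L₁ L₂
  | inl (x : L₁) (hx : x ≠ ⊤) : StarLattice L₁ L₂
  | inr (x : L₂) (hx : x ≠ ⊤) : StarLattice L₁ L₂

namespace StarLattice

section order

variable {L₁ : Type u₁} {L₂ : Type u₂} [LE L₁] [OrderTop L₁] [LE L₂] [OrderTop L₂]

/-- The order of `L₁ * L₂`. -/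
inductive Le : StarLattice L₁ L₂ → StarLattice L₁ L₂ → Prop
  | le_top (x : StarLattice L₁ L₂) : Le x top
  | bot_le (y : StarLattice L₁ L₂) : Le bot y
  | inl_le_inl {x y : L₁} (hx : x ≠ ⊤) (hy : y ≠ ⊤) (h : x ≤ y) : Le (inl x hx) (inl y hy)
  | inr_le_inr {x y : L₂} (hx : x ≠ ⊤) (hy : y ≠ ⊤) (h : x ≤ y) : Le (inr x hx) (inr y hy)

instance : LE (StarLattice L₁ L₂) := ⟨Le⟩

end order

variable {L₁ : Type u₁} {L₂ : Type u₂}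

instance [PartialOrder L₁] [OrderTop L₁] [PartialOrder L₂] [OrderTop L₂] :
    PartialOrder (StarLattice L₁ L₂) where
  le := Le
  le_refl x := by cases x <;> constructor <;> exact le_rfl
  le_trans x y z hxy hyz := by
    cases hxy <;> cases hyz <;> constructor <;> exact le_trans ‹_› ‹_›
  le_antisymm x y hxy hyx := by
    cases hxy <;> cases hyx <;> first | rfl | (congr 1; exact le_antisymm ‹_› ‹_›)

instance [LE L₁] [OrderTop L₁] [LE L₂] [OrderTop L₂] : BoundedOrder (StarLattice L₁ L₂) where
  bot := bot
  top := top
  bot_le := Le.bot_le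
  le_top := Le.le_top

section lattice

variable [Lattice L₁] [OrderTop L₁] [Lattice L₂] [OrderTop L₂]

open Classical in
/-- The join of `L₁ * L₂`. -/
noncomputable def join : StarLattice L₁ L₂ → StarLattice L₁ L₂ → StarLattice L₁ L₂
  | bot, y => y
  | x, bot => x
  | inl x _, inl y _ => if h : x ⊔ y ≠ ⊤ then inl (x ⊔ y) h else top
  | inr x _, inr y _ => if h : x ⊔ y ≠ ⊤ then inr (x ⊔ y) h else top
  | _, _ => top

/-- The meet of `L₁ * L₂`. -/
def meet : StarLattice L₁ L₂ → StarLattice L₁ L₂ → StarLattice L₁ L₂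
  | top, y => y
  | x, top => x
  | inl x hx, inl y _ => inl (x ⊓ y) fun h => hx (top_le_iff.1 (h ▸ inf_le_left))
  | inr x hx, inr y _ => inr (x ⊓ y) fun h => hx (top_le_iff.1 (h ▸ inf_le_left))
  | _, _ => bot

theorem le_join_left (x y : StarLattice L₁ L₂) : Le x (join x y) := by
  cases x <;> cases y <;> simp only [join] <;> (try split_ifs) <;>
    constructor <;> first | exact le_rfl | exact le_sup_left

theorem le_join_right (x y : StarLattice L₁ L₂) : Le y (join x y) := by
  cases x <;> cases y <;> simp only [join] <;> (try split_ifs) <;>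
    constructor <;> first | exact le_rfl | exact le_sup_right

theorem join_le (x y z : StarLattice L₁ L₂) (hx : Le x z) (hy : Le y z) : Le (join x y) z := by
  cases hx with
  | le_top => exact Le.le_top _
  | bot_le => cases y <;> exact hy
  | inl_le_inl h1 h2 h =>
    cases hy with
    | bot_le => exact Le.inl_le_inl _ _ h
    | inl_le_inl h3 _ h' =>
      have h4 := sup_le h h'
      simp only [join]
      split_ifs with h5
      · exact Le.inl_le_inl _ _ h4
      · exact absurd (top_le_iff.1 ((not_not.1 h5) ▸ h4)) h2
  | inr_le_inr h1 h2 h =>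
    cases hy with
    | bot_le => exact Le.inr_le_inr _ _ h
    | inr_le_inr h3 _ h' =>
      have h4 := sup_le h h'
      simp only [join]
      split_ifs with h5
      · exact Le.inr_le_inr _ _ h4
      · exact absurd (top_le_iff.1 ((not_not.1 h5) ▸ h4)) h2

theorem meet_le_left (x y : StarLattice L₁ L₂) : Le (meet x y) x := by
  cases x <;> cases y <;> simp only [meet] <;>
    constructor <;> first | exact le_rfl | exact inf_le_left

theorem meet_le_right (x y : StarLattice L₁ L₂) : Le (meet x y) y := by
  cases x <;> cases y <;> simp only [meet] <;>
    constructor <;> first | exact le_rfl | exact inf_le_right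

theorem le_meet (x y z : StarLattice L₁ L₂) (hy : Le x y) (hz : Le x z) : Le x (meet y z) := by
  cases hy with
  | bot_le => exact Le.bot_le _
  | le_top => cases z <;> exact hz
  | inl_le_inl h1 h2 h =>
    cases hz with
    | le_top => exact Le.inl_le_inl _ _ h
    | inl_le_inl _ h3 h' => exact Le.inl_le_inl _ _ (le_inf h h')
  | inr_le_inr h1 h2 h =>
    cases hz with
    | le_top => exact Le.inr_le_inr _ _ h
    | inr_le_inr _ h3 h' => exact Le.inr_le_inr _ _ (le_inf h h')

noncomputable instance : Lattice (StarLattice L₁ L₂) where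
  sup := join
  inf := meet
  le_sup_left := le_join_left
  le_sup_right := le_join_right
  sup_le := join_le
  inf_le_left := meet_le_left
  inf_le_right := meet_le_right
  le_inf := le_meet

end lattice

instance [LE L₁] [OrderTop L₁] [LE L₂] [OrderTop L₂] [Finite L₁] [Finite L₂] :
    Finite (StarLattice L₁ L₂) := by
  let f : Option (Option ({x : L₁ // x ≠ ⊤} ⊕ {x : L₂ // x ≠ ⊤})) → StarLattice L₁ L₂ := fun o =>
    match o with
    | none => bot
    | some none => top
    | some (some (Sum.inl x)) => inl x.1 x.2
    | some (some (Sum.inr x)) => inr x.1 x.2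
  refine Finite.of_surjective f fun s => ?_
  cases s with
  | bot => exact ⟨none, rfl⟩
  | top => exact ⟨some none, rfl⟩
  | inl x hx => exact ⟨some (some (Sum.inl ⟨x, hx⟩)), rfl⟩
  | inr x hx => exact ⟨some (some (Sum.inr ⟨x, hx⟩)), rfl⟩

end StarLattice

/-! Let `X₁`, `X₂` be the cyclic flats of `M` matching the least elements of `L₁`, `L₂`, and `T` the
largest cyclic flat; `r` is the rank. Contracting a cyclic flat keeps exactly the cyclic flats above
it, so `M ／ X₁` and `M ／ X₂` have lattices `L₁` and `L₂` and are transversal. Their presentations,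
cut down to `T`, are put together with `k = r(X₁) + r(X₂) - r(T)` copies of `T \ M.loops` and a
singleton for each element outside `T` (a coloop of `M`). The result presents `M`.

Independent sets are partial transversals by Hall's theorem: its inequality is submodularity of rank
for `S ∪ X₁` and `S ∪ X₂`, whose union spans `T`. Conversely, a circuit inside a partial transversal
spans a cyclic flat that consists of loops or contains some `Xᵢ`. The first is impossible since no
set of the family contains a loop; in the second, rank bounds in both contractions make the circuit
too small (`isTransversal_of_contract`). -/

open Set

/-- `I` is a partial transversal of the family `A`. -/
def IsPartialTransversal {α : Type*} {ι : Type*} (A : ι → Set α) (I : Set α) : Prop :=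
  ∃ f : I → ι, Function.Injective f ∧ ∀ e : I, (e : α) ∈ A (f e)

/-! ### Partial transversals and Hall's theorem. -/

namespace IsPartialTransversal

variable {α ι κ : Type*} {A : ι → Set α} {B : κ → Set α} {I J S : Set α}

theorem inter_right (h : IsPartialTransversal A I) (hI : I ⊆ S) :
    IsPartialTransversal (fun i => A i ∩ S) I := by
  obtain ⟨f, hf, hfA⟩ := h
  exact ⟨f, hf, fun e => ⟨hfA e, hI e.2⟩⟩

theorem mono_left {A' : ι → Set α} (h : IsPartialTransversal A I) (hA : ∀ i, A i ⊆ A' i) :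
    IsPartialTransversal A' I := by
  obtain ⟨f, hf, hfA⟩ := h
  exact ⟨f, hf, fun e => hA _ (hfA e)⟩

theorem subset_iUnion (h : IsPartialTransversal A I) : I ⊆ ⋃ i, A i := by
  obtain ⟨f, -, hfA⟩ := h
  exact fun e he => mem_iUnion.2 ⟨_, hfA ⟨e, he⟩⟩

/-- The easy half of Hall's theorem: each index used by the matching has a set that meets `S`. -/
theorem encard_le (h : IsPartialTransversal A I) (hI : I ⊆ S) :
    I.encard ≤ {i | (A i ∩ S).Nonempty}.encard := by
  obtain ⟨f, hf, hfA⟩ := h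
  have h1 : (range f).encard = I.encard := by
    rw [← image_univ, hf.encard_image, encard_univ, ENat.card_coe_set_eq]
  rw [← h1]
  refine encard_le_encard ?_
  rintro _ ⟨e, rfl⟩
  exact ⟨e, hfA e, hI e.2⟩

theorem encard_le_card (h : IsPartialTransversal A I) : I.encard ≤ ENat.card ι := by
  rw [← encard_univ]
  exact (h.encard_le Subset.rfl).trans (encard_le_encard (subset_univ _))

theorem sumElim (hI : IsPartialTransversal A I) (hJ : IsPartialTransversal B J) :
    IsPartialTransversal (Sum.elim A B) (I ∪ J) := by
  classical
  obtain ⟨f, hf, hfA⟩ := hI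
  obtain ⟨g, hg, hgB⟩ := hJ
  have hmem : ∀ e : ↥(I ∪ J), (e : α) ∉ I → (e : α) ∈ J := fun e he => e.2.resolve_left he
  refine ⟨fun e => if h : (e : α) ∈ I then .inl (f ⟨e, h⟩) else .inr (g ⟨e, hmem e h⟩), ?_, ?_⟩
  · intro a b hab
    dsimp only at hab
    split_ifs at hab with ha hb hb
    · exact Subtype.ext (congrArg (fun x : I => (x : α)) (hf (Sum.inl_injective hab)))
    · exact Subtype.ext (congrArg (fun x : J => (x : α)) (hg (Sum.inr_injective hab)))
  · intro e
    dsimp only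
    split_ifs with h
    · exact hfA _
    · exact hgB _

theorem exists_eq_union (h : IsPartialTransversal (Sum.elim A B) I) :
    ∃ J K, I = J ∪ K ∧ IsPartialTransversal A J ∧ IsPartialTransversal B K := by
  obtain ⟨f, hf, hfA⟩ := h
  refine ⟨{e | ∃ (h : e ∈ I) (i : ι), f ⟨e, h⟩ = .inl i},
    {e | ∃ (h : e ∈ I) (i : κ), f ⟨e, h⟩ = .inr i}, ?_, ?_, ?_⟩
  · ext e
    constructor
    · intro he
      rcases hfe : f ⟨e, he⟩ with i | i
      · exact .inl ⟨he, i, hfe⟩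
      · exact .inr ⟨he, i, hfe⟩
    · rintro (⟨he, -⟩ | ⟨he, -⟩) <;> exact he
  · choose hI g hg using fun e : {e | ∃ (h : e ∈ I) (i : ι), f ⟨e, h⟩ = .inl i} => e.2
    refine ⟨g, fun a b hab => ?_, fun e => ?_⟩
    · have h1 := hf ((hg a).trans (hab ▸ (hg b).symm))
      exact Subtype.ext (congrArg (fun x : I => (x : α)) h1)
    · have h1 := hfA ⟨e, hI e⟩
      rwa [hg e] at h1
  · choose hI g hg using fun e : {e | ∃ (h : e ∈ I) (i : κ), f ⟨e, h⟩ = .inr i} => e.2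
    refine ⟨g, fun a b hab => ?_, fun e => ?_⟩
    · have h1 := hf ((hg a).trans (hab ▸ (hg b).symm))
      exact Subtype.ext (congrArg (fun x : I => (x : α)) h1)
    · have h1 := hfA ⟨e, hI e⟩
      rwa [hg e] at h1

theorem encard_setOf_sumElim (A : ι → Set α) (B : κ → Set α) (S : Set α) :
    {i | (Sum.elim A B i ∩ S).Nonempty}.encard =
      {i | (A i ∩ S).Nonempty}.encard + {i | (B i ∩ S).Nonempty}.encard := by
  have h : {i | (Sum.elim A B i ∩ S).Nonempty} =
      Sum.inl '' {i | (A i ∩ S).Nonempty} ∪ Sum.inr '' {i | (B i ∩ S).Nonempty} := by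
    ext (i | i) <;> simp
  rw [h, encard_union_eq, Sum.inl_injective.encard_image, Sum.inr_injective.encard_image]
  rw [Set.disjoint_left]
  rintro _ ⟨i, -, rfl⟩ ⟨j, -, h⟩
  cases h

/-- Hall's marriage theorem. -/
theorem of_encard_le [Finite ι] (h : ∀ S ⊆ I, S.encard ≤ {i | (A i ∩ S).Nonempty}.encard) :
    IsPartialTransversal A I := by
  classical
  have := Fintype.ofFinite ι
  refine (Fintype.all_card_le_filter_rel_iff_exists_injective
    (fun (e : I) (i : ι) => (e : α) ∈ A i)).1 fun S => ?_
  have h1 := h (Subtype.val '' (S : Set I)) (by rintro _ ⟨e, -, rfl⟩; exact e.2)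
  rw [Subtype.val_injective.encard_image, encard_coe_eq_coe_finsetCard] at h1
  have h2 : {i | (A i ∩ Subtype.val '' (S : Set I)).Nonempty} =
      ((Finset.univ.filter fun i => ∃ e ∈ S, (e : α) ∈ A i : Finset ι) : Set ι) := by
    ext i
    constructor
    · rintro ⟨_, he, e, heS, rfl⟩
      exact Finset.mem_coe.2 (Finset.mem_filter.2 ⟨Finset.mem_univ i, e, heS, he⟩)
    · intro hi
      obtain ⟨e, heS, he⟩ := (Finset.mem_filter.1 hi).2
      exact ⟨e, he, e, heS, rfl⟩
  rw [h2, encard_coe_eq_coe_finsetCard] at h1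
  exact_mod_cast h1

end IsPartialTransversal

/-! ### Cyclic flats and contraction. -/

namespace Matroid

variable {α : Type v} {M : Matroid α} {X Y F T I J S : Set α}

theorem isTransversal_of_family {ι : Type*} [Finite ι] (A : ι → Set α) (hA : ∀ i, A i ⊆ M.E)
    (h : ∀ I, M.Indep I ↔ IsPartialTransversal A I) : M.IsTransversal := by
  obtain ⟨m, ⟨e⟩⟩ := Finite.exists_equiv_fin ι
  refine ⟨m, A ∘ e.symm, fun i => hA _, fun I => (h I).trans ⟨?_, ?_⟩⟩
  · rintro ⟨f, hf, hfA⟩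
    exact ⟨e ∘ f, e.injective.comp hf, by simpa using hfA⟩
  · rintro ⟨f, hf, hfA⟩
    exact ⟨e.symm ∘ f, e.symm.injective.comp hf, hfA⟩

/-- This form mentions only closures in `M`, so it passes easily through contractions and unions. -/
theorem isCyclicFlat_iff :
    M.IsCyclicFlat X ↔ M.IsFlat X ∧ ∀ e ∈ X, e ∈ M.closure (X \ {e}) := by
  refine and_congr_right fun hX => ?_
  have key : ∀ e ∈ X, ((M ↾ X).IsColoop e ↔ e ∉ M.closure (X \ {e})) := fun e he => by
    rw [isColoop_iff_notMem_closure_compl (M := M ↾ X) he, restrict_ground_eq,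
      M.restrict_closure_eq sdiff_subset hX.subset_ground]
    simp [he]
  constructor
  · intro h e he
    by_contra h'
    exact h e ((key e he).2 h')
  · intro h e he
    have heX : e ∈ X := he.mem_ground
    exact (key e heX).1 he (h e heX)

theorem isCyclicFlat_closure (hX : X ⊆ M.E) (h : ∀ e ∈ X, e ∈ M.closure (X \ {e})) :
    M.IsCyclicFlat (M.closure X) := by
  refine isCyclicFlat_iff.2 ⟨M.isFlat_closure X, fun e he => ?_⟩
  by_cases heX : e ∈ X
  · exact M.closure_subset_closure (sdiff_subset_sdiff_left (M.subset_closure X)) (h e heX)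
  · exact M.closure_subset_closure
      (subset_sdiff_singleton (M.subset_closure X) heX) he

theorem IsCircuit.isCyclicFlat_closure {C : Set α} (hC : M.IsCircuit C) :
    M.IsCyclicFlat (M.closure C) :=
  Matroid.isCyclicFlat_closure hC.subset_ground fun _ => hC.mem_closure_sdiff_singleton_of_mem

theorem isCyclicFlat_loops (M : Matroid α) : M.IsCyclicFlat M.loops :=
  isCyclicFlat_closure (empty_subset _) (by simp)

theorem IsCyclicFlat.closure_union (hX : M.IsCyclicFlat X) (hY : M.IsCyclicFlat Y) :
    M.IsCyclicFlat (M.closure (X ∪ Y)) := by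
  refine isCyclicFlat_closure (union_subset hX.1.subset_ground hY.1.subset_ground) ?_
  rintro e (he | he)
  · exact M.closure_subset_closure (sdiff_subset_sdiff_left subset_union_left)
      ((isCyclicFlat_iff.1 hX).2 e he)
  · exact M.closure_subset_closure (sdiff_subset_sdiff_left subset_union_right)
      ((isCyclicFlat_iff.1 hY).2 e he)

theorem IsCyclicFlat.diff_contract (hF : M.IsCyclicFlat F) (hXF : X ⊆ F) :
    (M ／ X).IsCyclicFlat (F \ X) := by
  rw [isCyclicFlat_iff] at hF ⊢
  constructor
  · rw [isFlat_iff_closure_eq, contract_closure_eq, sdiff_union_of_subset hXF, hF.1.closure]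
  · intro e he
    rw [contract_closure_eq]
    refine ⟨M.closure_subset_closure ?_ (hF.2 e he.1), he.2⟩
    intro x hx
    by_cases hxX : x ∈ X
    · exact .inr hxX
    · exact .inl ⟨⟨hx.1, hxX⟩, hx.2⟩

/-- Elements of `F` are spanned by the rest together with `X`. Elements of `X` need `X` itself to be
cyclic. -/
theorem IsCyclicFlat.union_of_contract (hX : M.IsCyclicFlat X) (hF : (M ／ X).IsCyclicFlat F) :
    M.IsCyclicFlat (F ∪ X) := by
  rw [isCyclicFlat_iff] at hF hX ⊢
  have hdj : Disjoint F X := (subset_sdiff.1 hF.1.subset_ground).2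
  constructor
  · have h1 := hF.1.closure
    rw [contract_closure_eq] at h1
    have h2 : M.closure (F ∪ X) = F ∪ X := by
      conv_rhs => rw [← h1]
      exact (sdiff_union_of_subset ((M.subset_closure X hX.1.subset_ground).trans
        (M.closure_subset_closure subset_union_right))).symm
    exact isFlat_iff_closure_eq.2 h2
  · rintro e (he | he)
    · have h1 := hF.2 e he
      rw [contract_closure_eq] at h1
      refine M.closure_subset_closure ?_ h1.1
      rintro x (hx | hx)
      · exact ⟨.inl hx.1, hx.2⟩
      · refine ⟨.inr hx, ?_⟩
        rintro rfl
        exact hdj.le_bot ⟨he, hx⟩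
    · exact M.closure_subset_closure (sdiff_subset_sdiff_left subset_union_right) (hX.2 e he)

/-- The cyclic flats of the contraction of a cyclic flat `X` are the cyclic flats above `X`. -/
def cyclicFlatContractIso (hX : M.IsCyclicFlat X) :
    (M ／ X).CyclicFlat ≃o {F : M.CyclicFlat // X ⊆ F.1} where
  toFun F := ⟨⟨F.1 ∪ X, hX.union_of_contract F.2⟩, subset_union_right⟩
  invFun F := ⟨F.1.1 \ X, F.1.2.diff_contract F.2⟩
  left_inv F := Subtype.ext <|
    union_sdiff_cancel_right (subset_sdiff.1 F.2.1.subset_ground).2.le_bot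
  right_inv F := Subtype.ext <| Subtype.ext <| sdiff_union_of_subset F.2
  map_rel_iff' {F G} := by
    change F.1 ∪ X ⊆ G.1 ∪ X ↔ F.1 ⊆ G.1
    have hdj : Disjoint F.1 X := (subset_sdiff.1 F.2.1.subset_ground).2
    exact ⟨fun h x hx => (h (.inl hx)).resolve_right fun hxX => hdj.le_bot ⟨hx, hxX⟩,
      fun h => union_subset_union_left X h⟩

theorem encard_add_eRk_le_of_contract_indep (hX : X ⊆ M.E) (hJ : (M ／ X).Indep J) (hJF : J ⊆ F)
    (hXF : X ⊆ F) : J.encard + M.eRk X ≤ M.eRk F := by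
  obtain ⟨K, hK⟩ := M.exists_isBasis X
  obtain ⟨hJK, hdj⟩ := hK.contract_indep_iff.1 hJ
  rw [← hK.encard_eq_eRk, ← encard_union_eq (hdj.symm.mono_right hK.subset)]
  exact hJK.encard_le_eRk_of_subset (union_subset hJF (hK.subset.trans hXF))

/-- Extend a basis `K` of `X` to a basis `B` of `S ∪ X`. Maximality of `K` in `X` puts `B \ K`
inside `S`, off `X`. -/
theorem exists_contract_indep_encard_add_eRk (hX : X ⊆ M.E) (hS : S ⊆ M.E) :
    ∃ J ⊆ S, (M ／ X).Indep J ∧ J.encard + M.eRk X = M.eRk (S ∪ X) := by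
  obtain ⟨K, hK⟩ := M.exists_isBasis X
  obtain ⟨B, hB, hKB⟩ := hK.indep.subset_isBasis_of_subset
    (hK.subset.trans (subset_union_right (s := S))) (union_subset hS hX)
  have hBX : B ∩ X ⊆ K := by
    have h1 := hK.eq_of_subset_indep (hB.indep.subset inter_subset_left)
      (subset_inter hKB hK.subset) inter_subset_right
    exact h1.symm.subset
  refine ⟨B \ K, ?_, hK.contract_indep_iff.2 ⟨?_, ?_⟩, ?_⟩
  · rintro e ⟨he, heK⟩
    exact (hB.subset he).resolve_right fun heX => heK (hBX ⟨he, heX⟩)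
  · rw [sdiff_union_of_subset hKB]
    exact hB.indep
  · rw [Set.disjoint_left]
    exact fun e heX he => he.2 (hBX ⟨he.1, heX⟩)
  · rw [← hK.encard_eq_eRk, ← hB.encard_eq_eRk, encard_sdiff_add_encard_of_subset hKB]

end Matroid

/-! ### Gluing presentations of two contractions. -/

namespace Matroid

variable {α : Type v} {M : Matroid α}

/-- The hypotheses retain all that is needed of the order on `L₁ * L₂`: `T` is the top and the join
of `X₁` and `X₂`, and every cyclic flat other than the bottom lies above `X₁` or `X₂`. -/
theorem isTransversal_of_contract [M.Finite] {X₁ X₂ T : Set α} (hX₁ : M.IsCyclicFlat X₁)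
    (hX₂ : M.IsCyclicFlat X₂) (hT : M.IsCyclicFlat T) (hmax : ∀ F, M.IsCyclicFlat F → F ⊆ T)
    (hjoin : ∀ F, M.IsCyclicFlat F → X₁ ⊆ F → X₂ ⊆ F → T ⊆ F)
    (hcover : ∀ F, M.IsCyclicFlat F → F ⊆ M.loops ∨ X₁ ⊆ F ∨ X₂ ⊆ F)
    (h₁ : (M ／ X₁).IsTransversal) (h₂ : (M ／ X₂).IsTransversal) : M.IsTransversal := by
  obtain ⟨m₁, A₁, -, hA₁⟩ := h₁
  obtain ⟨m₂, A₂, -, hA₂⟩ := h₂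
  change ∀ I, _ ↔ IsPartialTransversal A₁ I at hA₁
  change ∀ I, _ ↔ IsPartialTransversal A₂ I at hA₂
  have hX₁E := hX₁.1.subset_ground
  have hX₂E := hX₂.1.subset_ground
  have hTE := hT.1.subset_ground
  have hX₁T := hmax _ hX₁
  have hX₂T := hmax _ hX₂
  have hfin : ∀ S, M.eRk S ≠ ⊤ := fun S => eRk_ne_top_iff.2 (M.isRkFinite_set S)
  have hspan : M.eRk (X₁ ∪ X₂) = M.eRk T := by
    refine le_antisymm (M.eRk_mono (union_subset hX₁T hX₂T)) ?_
    rw [← M.eRk_closure_eq (X₁ ∪ X₂)]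
    have h := union_subset_iff.1 (M.subset_closure (X₁ ∪ X₂) (union_subset hX₁E hX₂E))
    exact M.eRk_mono (hjoin _ (hX₁.closure_union hX₂) h.1 h.2)
  -- Submodularity makes `r(X₁) + r(X₂) - r(T)` nonnegative, so the natural subtraction below is
  -- exact.
  obtain ⟨k, hk⟩ : ∃ k : ℕ, k + M.eRk T = M.eRk X₁ + M.eRk X₂ := by
    have h := M.eRk_union_le_eRk_add_eRk X₁ X₂
    rw [hspan] at h
    lift M.eRk T to ℕ using hfin T with t
    lift M.eRk X₁ to ℕ using hfin X₁ with x₁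
    lift M.eRk X₂ to ℕ using hfin X₂ with x₂
    norm_cast at h ⊢
    exact ⟨x₁ + x₂ - t, by omega⟩
  have : Finite ↥(M.E \ T) := (M.ground_finite.subset sdiff_subset).to_subtype
  let A : (Fin m₁ ⊕ Fin m₂) ⊕ Fin k → Set α :=
    Sum.elim (Sum.elim (fun i => A₁ i ∩ T) fun i => A₂ i ∩ T) fun _ => T \ M.loops
  let B : ↥(M.E \ T) → Set α := fun e => {e.1}
  refine isTransversal_of_family (Sum.elim A B) ?_ fun I => ⟨fun hI => ?_, fun hI => ?_⟩
  · rintro (((i | i) | i) | e)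
    · exact inter_subset_right.trans hTE
    · exact inter_subset_right.trans hTE
    · exact sdiff_subset.trans hTE
    · exact singleton_subset_iff.2 e.2.1
  -- Elements outside `T` are matched to their own singletons; Hall's theorem handles `I ∩ T`.
  · rw [← inter_union_sdiff I T]
    refine IsPartialTransversal.sumElim (IsPartialTransversal.of_encard_le fun S hS => ?_)
      ⟨fun e => ⟨e, hI.subset_ground e.2.1, e.2.2⟩,
        fun a b hab => Subtype.ext (congrArg (fun x : ↥(M.E \ T) => (x : α)) hab), fun e => rfl⟩
    obtain rfl | ⟨e, heS⟩ := S.eq_empty_or_nonempty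
    · simp
    have hST : S ⊆ T := hS.trans inter_subset_right
    have hSI : M.Indep S := hI.subset (hS.trans inter_subset_left)
    obtain ⟨J₁, hJ₁S, hJ₁, hr₁⟩ :=
      exists_contract_indep_encard_add_eRk hX₁E hSI.subset_ground
    obtain ⟨J₂, hJ₂S, hJ₂, hr₂⟩ :=
      exists_contract_indep_encard_add_eRk hX₂E hSI.subset_ground
    have hc₁ := (((hA₁ J₁).1 hJ₁).inter_right (hJ₁S.trans hST)).encard_le hJ₁S
    have hc₂ := (((hA₂ J₂).1 hJ₂).inter_right (hJ₂S.trans hST)).encard_le hJ₂S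
    have hck : {i : Fin k | ((T \ M.loops) ∩ S).Nonempty}.encard = k := by
      have : ((T \ M.loops) ∩ S).Nonempty :=
        ⟨e, ⟨hST heS, (hSI.isNonloop_of_mem heS).not_isLoop⟩, heS⟩
      simp [this]
    rw [IsPartialTransversal.encard_setOf_sumElim, IsPartialTransversal.encard_setOf_sumElim, hck]
    -- With `|Jᵢ| = r(S ∪ Xᵢ) - r(Xᵢ)` and the value of `k`, the claim becomes `r(S) + r(T) ≤ r(S ∪
    -- X₁) + r(S ∪ X₂)`.
    refine le_trans ?_ (add_le_add_left (add_le_add hc₁ hc₂) _)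
    have hsub := M.eRk_inter_add_eRk_union_le (S ∪ X₁) (S ∪ X₂)
    have h1 : M.eRk S ≤ M.eRk ((S ∪ X₁) ∩ (S ∪ X₂)) :=
      M.eRk_mono (subset_inter subset_union_left subset_union_left)
    have h2 : M.eRk T ≤ M.eRk ((S ∪ X₁) ∪ (S ∪ X₂)) := by
      rw [← hspan]
      exact M.eRk_mono (union_subset_union subset_union_right subset_union_right)
    have h3 := (add_le_add h1 h2).trans hsub
    rw [hSI.eRk_eq_encard, ← hr₁, ← hr₂] at h3
    have hf : ∀ J ⊆ S, J.encard ≠ ⊤ := fun J hJ =>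
      ((M.ground_finite.subset hSI.subset_ground).subset hJ).encard_lt_top.ne
    lift M.eRk T to ℕ using hfin T with t
    lift M.eRk X₁ to ℕ using hfin X₁ with x₁
    lift M.eRk X₂ to ℕ using hfin X₂ with x₂
    lift J₁.encard to ℕ using hf J₁ hJ₁S with j₁
    lift J₂.encard to ℕ using hf J₂ hJ₂S with j₂
    lift S.encard to ℕ using hf S Subset.rfl with s
    norm_cast at *
    omega
  · obtain ⟨I', Ic, rfl, hI', hIc⟩ := hI.exists_eq_union
    obtain ⟨I₁₂, I₀, rfl, hI₁₂, hI₀⟩ := hI'.exists_eq_union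
    obtain ⟨I₁, I₂, rfl, hI₁, hI₂⟩ := hI₁₂.exists_eq_union
    have hIcE : Ic ⊆ M.E \ T := hIc.subset_iUnion.trans
      (iUnion_subset fun e => singleton_subset_iff.2 e.2)
    have hI₀' : I₀ ⊆ T \ M.loops := hI₀.subset_iUnion.trans (iUnion_subset fun _ => Subset.rfl)
    have hI₁' : (M ／ X₁).Indep I₁ := (hA₁ I₁).2 (hI₁.mono_left fun _ => inter_subset_left)
    have hI₂' : (M ／ X₂).Indep I₂ := (hA₂ I₂).2 (hI₂.mono_left fun _ => inter_subset_left)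
    have hIE : I₁ ∪ I₂ ∪ I₀ ∪ Ic ⊆ M.E := union_subset (union_subset
      (union_subset hI₁'.of_contract.subset_ground hI₂'.of_contract.subset_ground)
        (hI₀'.trans (sdiff_subset.trans hTE))) (hIcE.trans sdiff_subset)
    by_contra hdep
    obtain ⟨C, hCI, hC⟩ := ((not_indep_iff hIE).1 hdep).exists_isCircuit_subset
    -- A circuit spans a cyclic flat, hence lies in `T` and misses the singletons' part `Ic`.
    have hCT : C ⊆ T := (M.subset_closure C hC.subset_ground).trans (hmax _ hC.isCyclicFlat_closure)
    have hCI' : C ⊆ I₁ ∪ I₂ ∪ I₀ := fun e he =>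
      (hCI he).resolve_right fun heI => (hIcE heI).2 (hCT he)
    have hCcard : C.encard ≤ (I₁ ∩ C).encard + (I₂ ∩ C).encard + k := by
      have h0 : (I₀ ∩ C).encard ≤ k :=
        (encard_le_encard inter_subset_left).trans (by simpa using hI₀.encard_le_card)
      calc C.encard ≤ ((I₁ ∩ C) ∪ (I₂ ∩ C) ∪ (I₀ ∩ C)).encard := by
            refine encard_le_encard fun e he => ?_
            rcases hCI' he with (h | h) | h
            · exact .inl (.inl ⟨h, he⟩)
            · exact .inl (.inr ⟨h, he⟩)
            · exact .inr ⟨h, he⟩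
        _ ≤ _ := (encard_union_le _ _).trans (add_le_add (encard_union_le _ _) h0)
    have hCr := hC.eRk_add_one_eq
    have hf : ∀ J ⊆ C, J.encard ≠ ⊤ := fun J hJ =>
      ((M.ground_finite.subset hC.subset_ground).subset hJ).encard_lt_top.ne
    have hCF := M.subset_closure C hC.subset_ground
    have hb₁ : ∀ F, X₁ ⊆ F → C ⊆ F → (I₁ ∩ C).encard + M.eRk X₁ ≤ M.eRk F := fun F hXF hCF =>
      encard_add_eRk_le_of_contract_indep hX₁E (hI₁'.subset inter_subset_left)
        (inter_subset_right.trans hCF) hXF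
    have hb₂ : ∀ F, X₂ ⊆ F → C ⊆ F → (I₂ ∩ C).encard + M.eRk X₂ ≤ M.eRk F := fun F hXF hCF =>
      encard_add_eRk_le_of_contract_indep hX₂E (hI₂'.subset inter_subset_left)
        (inter_subset_right.trans hCF) hXF
    have hb₁T := hb₁ T hX₁T hCT
    have hb₂T := hb₂ T hX₂T hCT
    rcases hcover _ hC.isCyclicFlat_closure with hl | hl | hl
    · obtain ⟨e, heC⟩ := hC.nonempty
      have hloop : M.IsLoop e := hl (hCF heC)
      rcases hCI' heC with (he | he) | he
      · exact (hI₁'.of_contract.isNonloop_of_mem he).not_isLoop hloop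
      · exact (hI₂'.of_contract.isNonloop_of_mem he).not_isLoop hloop
      · exact (hI₀' he).2 hloop
    -- Here `|I₁ ∩ C| ≤ r(C) - r(X₁)` since `X₁` lies in the closure of `C`, while `|I₂ ∩ C| ≤ r(T)
    -- - r(X₂)`. Adding `k` gives `|C| ≤ r(C)`, against `|C| = r(C) + 1`.
    · have hb := hb₁ _ hl hCF
      rw [eRk_closure_eq] at hb
      lift M.eRk T to ℕ using hfin T with t
      lift M.eRk X₁ to ℕ using hfin X₁ with x₁
      lift M.eRk X₂ to ℕ using hfin X₂ with x₂
      lift M.eRk C to ℕ using hfin C with c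
      lift (I₁ ∩ C).encard to ℕ using hf _ inter_subset_right with j₁
      lift (I₂ ∩ C).encard to ℕ using hf _ inter_subset_right with j₂
      lift C.encard to ℕ using hf C Subset.rfl with s
      norm_cast at *
      omega
    · have hb := hb₂ _ hl hCF
      rw [eRk_closure_eq] at hb
      lift M.eRk T to ℕ using hfin T with t
      lift M.eRk X₁ to ℕ using hfin X₁ with x₁
      lift M.eRk X₂ to ℕ using hfin X₂ with x₂
      lift M.eRk C to ℕ using hfin C with c
      lift (I₁ ∩ C).encard to ℕ using hf _ inter_subset_right with j₁
      lift (I₂ ∩ C).encard to ℕ using hf _ inter_subset_right with j₂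
      lift C.encard to ℕ using hf C Subset.rfl with s
      norm_cast at *
      omega

end Matroid

/-! ### The two factors as upper intervals of `L₁ * L₂`. -/

namespace StarLattice

variable {L₁ : Type u₁} {L₂ : Type u₂} [PartialOrder L₁] [BoundedOrder L₁] [PartialOrder L₂]
  [BoundedOrder L₂]

open Classical in
/-- The inclusion of `L₁` in `L₁ * L₂` that takes the greatest element to the greatest element. -/
noncomputable def left (x : L₁) : StarLattice L₁ L₂ := if h : x ≠ ⊤ then inl x h else ⊤

open Classical in
/-- The inclusion of `L₂` in `L₁ * L₂` that takes the greatest element to the greatest element. -/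
noncomputable def right (x : L₂) : StarLattice L₁ L₂ := if h : x ≠ ⊤ then inr x h else ⊤

theorem left_le_left {x y : L₁} : (left x : StarLattice L₁ L₂) ≤ left y ↔ x ≤ y := by
  unfold left
  split_ifs with hx hy hy
  · exact ⟨fun h => by cases h; assumption, fun h => Le.inl_le_inl _ _ h⟩
  · exact iff_of_true le_top (not_not.1 hy ▸ le_top)
  · exact iff_of_false (fun h => by cases h) fun h => hy (top_le_iff.1 (not_not.1 hx ▸ h))
  · exact iff_of_true le_rfl (not_not.1 hy ▸ le_top)

theorem right_le_right {x y : L₂} : (right x : StarLattice L₁ L₂) ≤ right y ↔ x ≤ y := by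
  unfold right
  split_ifs with hx hy hy
  · exact ⟨fun h => by cases h; assumption, fun h => Le.inr_le_inr _ _ h⟩
  · exact iff_of_true le_top (not_not.1 hy ▸ le_top)
  · exact iff_of_false (fun h => by cases h) fun h => hy (top_le_iff.1 (not_not.1 hx ▸ h))
  · exact iff_of_true le_rfl (not_not.1 hy ▸ le_top)

/-- When `L₁` has one element, `left ⊥` is the top and the interval above it is a single point;
hence the case split. -/
theorem exists_left_eq {z : StarLattice L₁ L₂} (h : left ⊥ ≤ z) : ∃ x, left x = z := by
  by_cases hb : (⊥ : L₁) ≠ ⊤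
  · rw [left, dif_pos hb] at h
    cases h with
    | le_top => exact ⟨⊤, dif_neg (not_not.2 rfl)⟩
    | inl_le_inl _ hy => exact ⟨_, dif_pos hy⟩
  · rw [left, dif_neg hb] at h
    exact ⟨⊤, (dif_neg (not_not.2 rfl)).trans (top_le_iff.1 h).symm⟩

theorem exists_right_eq {z : StarLattice L₁ L₂} (h : right ⊥ ≤ z) : ∃ x, right x = z := by
  by_cases hb : (⊥ : L₂) ≠ ⊤
  · rw [right, dif_pos hb] at h
    cases h with
    | le_top => exact ⟨⊤, dif_neg (not_not.2 rfl)⟩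
    | inr_le_inr _ hy => exact ⟨_, dif_pos hy⟩
  · rw [right, dif_neg hb] at h
    exact ⟨⊤, (dif_neg (not_not.2 rfl)).trans (top_le_iff.1 h).symm⟩

/-- `L₁` is the interval of `L₁ * L₂` above the image of its least element. -/
noncomputable def leftIso (L₁ : Type u₁) (L₂ : Type u₂) [PartialOrder L₁] [BoundedOrder L₁]
    [PartialOrder L₂] [BoundedOrder L₂] : L₁ ≃o {z : StarLattice L₁ L₂ // left ⊥ ≤ z} :=
  RelIso.ofSurjective
    (OrderEmbedding.ofMapLEIff (fun x => ⟨left x, left_le_left.2 bot_le⟩) fun _ _ => left_le_left)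
    fun z => (exists_left_eq z.2).imp fun _ hx => Subtype.ext hx

/-- `L₂` is the interval of `L₁ * L₂` above the image of its least element. -/
noncomputable def rightIso (L₁ : Type u₁) (L₂ : Type u₂) [PartialOrder L₁] [BoundedOrder L₁]
    [PartialOrder L₂] [BoundedOrder L₂] : L₂ ≃o {z : StarLattice L₁ L₂ // right ⊥ ≤ z} :=
  RelIso.ofSurjective
    (OrderEmbedding.ofMapLEIff (fun x => ⟨right x, right_le_right.2 bot_le⟩)
      fun _ _ => right_le_right)
    fun z => (exists_right_eq z.2).imp fun _ hx => Subtype.ext hx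

theorem eq_top_of_left_le_of_right_le {z : StarLattice L₁ L₂} (h₁ : left ⊥ ≤ z)
    (h₂ : right ⊥ ≤ z) : z = ⊤ := by
  obtain ⟨x, rfl⟩ := exists_left_eq h₁
  obtain ⟨y, hy⟩ := exists_right_eq h₂
  unfold left right at *
  split_ifs at * <;> rfl

theorem eq_bot_or_left_le_or_right_le (z : StarLattice L₁ L₂) :
    z = ⊥ ∨ left ⊥ ≤ z ∨ right ⊥ ≤ z := by
  cases z with
  | bot => exact .inl rfl
  | top => exact .inr (.inl le_top)
  | inl x hx =>
    have h : (left x : StarLattice L₁ L₂) = inl x hx := dif_pos hx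
    exact .inr (.inl (h ▸ left_le_left.2 bot_le))
  | inr x hx =>
    have h : (right x : StarLattice L₁ L₂) = inr x hx := dif_pos hx
    exact .inr (.inr (h ▸ right_le_right.2 bot_le))

end StarLattice

/-! ### From the lattice isomorphism to the theorem. -/

open scoped Matroid in
/-- If the interval above a point of a lattice isomorphic to the lattice of cyclic flats of `M` is
isomorphic to a Tr-lattice, then contracting the matching cyclic flat gives a transversal matroid. -/
theorem IsTrLattice.isTransversal_contract {L : Type u₁} [Lattice L] [Finite L]
    (h : IsTrLattice.{u₁, v} L) {P : Type u₂} [PartialOrder P] {α : Type v} {M : Matroid α}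
    [M.Finite] (φ : M.CyclicFlat ≃o P) (p : P) (ψ : L ≃o {z : P // p ≤ z}) :
    (M ／ (φ.symm p).1).IsTransversal := by
  have hX := (φ.symm p).2
  let χ : {F : M.CyclicFlat // (φ.symm p).1 ⊆ F.1} ≃o {z : P // p ≤ z} :=
    { toEquiv := φ.toEquiv.subtypeEquiv fun F => φ.symm_apply_le
      map_rel_iff' := fun {F G} => φ.le_iff_le }
  exact h α _ inferInstance ⟨((Matroid.cyclicFlatContractIso hX).trans χ).trans ψ.symm⟩


theorem mainTheorem6 (L₁ : Type u₁) (L₂ : Type u₂)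
    [Lattice L₁] [BoundedOrder L₁] [Finite L₁] [Lattice L₂] [BoundedOrder L₂] [Finite L₂]
    (h₁ : IsTrLattice.{u₁, v} L₁) (h₂ : IsTrLattice.{u₂, v} L₂) :
    IsTrLattice.{max u₁ u₂, v} (StarLattice L₁ L₂) := by
  rintro α M hM ⟨φ⟩
  let X₁ := φ.symm (StarLattice.left ⊥)
  let X₂ := φ.symm (StarLattice.right ⊥)
  refine Matroid.isTransversal_of_contract X₁.2 X₂.2 (φ.symm ⊤).2 (fun F hF => ?_)
    (fun F hF h1 h2 => ?_) (fun F hF => ?_)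
    (h₁.isTransversal_contract φ _ (StarLattice.leftIso L₁ L₂))
    (h₂.isTransversal_contract φ _ (StarLattice.rightIso L₁ L₂))
  · exact (φ.le_symm_apply (x := ⟨F, hF⟩)).2 le_top
  · have h : φ ⟨F, hF⟩ = ⊤ := StarLattice.eq_top_of_left_le_of_right_le
      ((φ.symm_apply_le (x := ⟨F, hF⟩)).1 h1) ((φ.symm_apply_le (x := ⟨F, hF⟩)).1 h2)
    exact (φ.symm_apply_le (x := ⟨F, hF⟩)).2 h.ge
  · rcases StarLattice.eq_bot_or_left_le_or_right_le (φ ⟨F, hF⟩) with h | h | h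
    -- The set of loops is itself a cyclic flat, so the bottom one is contained in it.
    · have hle : φ ⟨F, hF⟩ ≤ φ ⟨M.loops, M.isCyclicFlat_loops⟩ := h ▸ bot_le
      exact .inl (φ.le_iff_le.1 hle)
    · exact .inr (.inl ((φ.symm_apply_le (x := ⟨F, hF⟩)).2 h))
    · exact .inr (.inr ((φ.symm_apply_le (x := ⟨F, hF⟩)).2 h))
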